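/- **Setting.** Let $M$ be an $n$-dimensional smooth manifold, and let $U\subseteq M$ be open with a smooth frame $e_\alpha$ and covariant basic fields $e^\alpha$. Contraction of a covector with a vector is given by $S(e^\alpha,e_\beta)=f^\alpha{}_\beta$ with $\det(f^\alpha{}_\beta)\neq 0$. Let $\Gamma$ and $P$ be affine connections for contravariant and covariant tensors, commuting with $S$, and let $g$ be a symmetric non-degenerate covariant metric (an $(\overline L_n,g)$-space); $f,\Gamma,P,g$ are smooth. All juxtapositions below are contractions by $S$, and a bar over an index denotes contraction with $f$ ($v^{\bar\alpha}=f^\alpha{}_\beta v^\beta$, $p_{\bar\alpha}=f^\beta{}_\alpha p_\beta$). Thus $g(v)=g_{\alpha\bar\beta}v^\beta e^\alpha$, and $\overline g$ is the contravariant metric with $g_{\bar\alpha\bar\beta}g^{\beta\gamma}=\delta_\alpha^\gamma$. Let $u$ be a contravariant vector field with $e=g(u,u)=g_{\bar\alpha\bar\beta}u^\alpha u^\beta\neq0$ on $U$, and let $h^u=\overline g-\frac1e\,u\otimes u$, $h_u=g-\frac1e\,g(u)\otimes g(u)$; note that $h^u(h_u)=h^u(g)$. For a mixed tensor field $G=G_\alpha{}^\beta\,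 e_\beta\otimes e^\alpha$ put $$\rho_G=\tfrac1{e^2}[g(u)](G)(u),\quad {}^G\pi=\tfrac1e[g(u)](G)h^u,\quad {}^Gs=\tfrac1e h^u(g)(G)(u),\quad {}^GS=h^u(g)(G)h^u,$$ $$p_G=\rho_G u+{}^G\pi,\qquad e_G=G(u).$$ Let a Lagrangian system be given: non-metric tensor fields $V^A{}_B$ (finitely many, smooth) and a smooth Lagrangian invariant $L$, depending on the point and on the $K^A{}_B\sim(V^A{}_B,g_{\alpha\beta})$ and their first and second covariant derivatives. Let $$\frac{\delta L}{\delta K^A{}_B}=\frac{\partial L}{\partial K^A{}_B}-\Big(\frac{\partial L}{\partial K^A{}_{B/\gamma}}\Big)_{/\gamma}+\Big(\frac{\partial L}{\partial K^A{}_{B/\gamma/\delta}}\Big)_{/\delta/\gamma}.$$ For mixed tensor fields $\theta$ and ${}_sT$ the barred projections are those of the viscosity tensors: ${}^\theta\bar\pi,{}^\theta\bar s,{}^\theta\bar S$ are the projections $\pi,s,S$ of $\theta+L\cdot Kr$, and ${}^T\bar\pi,{}^T\bar s,{}^T\bar S$ those of ${}_sT+L\cdot Kr$, where $Kr=e_\alpha\otimes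 e^\alpha$; the quantities $\rho_\theta,p_\theta,e_\theta$ and $\rho_T,p_T,e_T$ are those of $\theta$ and ${}_sT$. For a mixed tensor field $Q$ the signs are reversed: $\rho_Q=-\frac1{e^2}[g(u)](Q)(u)$, ${}^Q\pi=-\frac1e[g(u)](Q)h^u$, ${}^Qs=-\frac1eh^u(g)(Q)(u)$, ${}^QS=-h^u(g)(Q)h^u$, $p_Q=\rho_Qu+{}^Q\pi$, $e_Q=-Q(u)$. **Statement.** Let $\theta,{}_sT,Q$ be mixed tensor fields as above. 1. The second covariant Noether identity $\theta-{}_sT\equiv Q$ holds on $U$ if and only if, on $U$, $$\rho_\theta\equiv\rho_T-\rho_Q,\quad {}^\theta\bar\pi\equiv{}^T\bar\pi-{}^Q\pi,\quad {}^\theta\bar s\equiv{}^T\bar s-{}^Qs,\quad {}^\theta\bar S\equiv{}^T\bar S-{}^QS .$$ 2. If $\theta-{}_sT\equiv Q$ on $U$, then $p_\theta\equiv p_T-p_Q$ and $e_\theta\equiv e_T-e_Q$ on $U$. 3. Let $Q={}_vQ+{}_gQ$ be the variational energy-momentum tensor of Euler–Lagrange of the Lagrangian system, where $({}_vQ)_\alpha{}^\beta$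 is minus the coefficient of $\xi^\alpha{}_{/\beta}$ in $\sum\frac{\delta_vL}{\delta V^A{}_B}(\pounds_\xi V)^A{}_B$, and $({}_gQ)_\alpha{}^\beta$ is minus that coefficient in $\frac{\delta_gL}{\delta g_{\gamma\delta}}(\pounds_\xi g)_{\gamma\delta}$ (the Lie derivative commuting with $S$). If $\theta-{}_sT\equiv Q$, the Euler–Lagrange equations $\delta_vL/\delta V^A{}_B=0$ hold and ${}_gQ=0$ on $U$, then on $U$ the projections of $Q$ vanish, $\rho_Q=0$, ${}^Q\pi=0$, ${}^Qs=0$, ${}^QS=0$, and the projections of $\theta$ and ${}_sT$ coincide: $\rho_\theta=\rho_T$, ${}^\theta\bar\pi={}^T\bar\pi$, ${}^\theta\bar s={}^T\bar s$, ${}^\theta\bar S={}^T\bar S$, $p_\theta=p_T$, $e_\theta=e_T$. -/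

import Mathlib

open scoped Manifold ContDiff Matrix

noncomputable section

namespace LbarN

/-! Spaces with contravariant and covariant affine connections and a metric, described in a
(not necessarily coordinate) frame `e_α` over an open set `U` of an `n`-dimensional smooth manifold.
All tensor fields are given by their components with respect to `e_α` and the covariant basic
vector fields `e^α`; the contraction of `e^α` with `e_β` is `f^α_β`. -/

/-- Components of a contravariant vector field, `v x α = v^α(x)`. -/
abbrev VecField (n : ℕ) (M : Type*) := M → Fin n → ℝ

/-- Components of a covariant vector field, `p x α = p_α(x)`. -/
abbrev CovecField (n : ℕ) (M : Type*) := M → Fin n → ℝ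

/-- Components of a mixed tensor field of second rank of type 1,
`G = G_α^β e_β ⊗ e^α`, with `G x α β = G_α^β(x)`. -/
abbrev MixedField (n : ℕ) (M : Type*) := M → Fin n → Fin n → ℝ

/-- Components of a contravariant tensor field of second rank,
`A = A^{αβ} e_α ⊗ e_β`, with `A x α β = A^{αβ}(x)`. -/
abbrev ContraField (n : ℕ) (M : Type*) := M → Fin n → Fin n → ℝ

/-- Components of a tensor field `K = K^A_B e_A ⊗ e^B` with `k` contravariant and `l` covariant
indices, `K x A B = K^A_B(x)`. -/
abbrev TField (n : ℕ) (M : Type*) (k l : ℕ) := M → (Fin k → Fin n) → (Fin l → Fin n) → ℝ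

/-- The Kronecker tensor field `Kr`. -/
def Kr {n : ℕ} {M : Type*} : MixedField n M := fun _ α β => if α = β then 1 else 0

/-- The viscosity tensor `_kG = G + L Kr` belonging to `G = _kG - L Kr`. Its projections `π, s, S`
are the barred projections of `G`. -/
def viscous {n : ℕ} {M : Type*} (L : M → ℝ) (G : MixedField n M) : MixedField n M := fun x => G x + L x • Kr x

/-- An `(L̄_n, g)`-space over the domain `U` of a smooth frame `e_α`. -/
structure Space (n : ℕ) (M : Type*) [TopologicalSpace M]
    [ChartedSpace (EuclideanSpace ℝ (Fin n)) M] [IsManifold (𝓡 n) ∞ M] where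
  U : Set M
  isOpen_U : IsOpen U
  /-- the contravariant basic vector fields `e_α` -/
  frame : Fin n → (x : M) → TangentSpace (𝓡 n) x
  frame_smooth : ∀ α, ContMDiffOn (𝓡 n) (𝓡 n).tangent ∞
    (fun x => (⟨x, frame α x⟩ : TangentBundle (𝓡 n) M)) U
  frame_indep : ∀ x ∈ U, LinearIndependent ℝ (fun α => frame α x)
  /-- the contraction `S(e^α, e_β) = f^α_β` -/
  f : M → Matrix (Fin n) (Fin n) ℝ
  f_smooth : ∀ α β, ContMDiffOn (𝓡 n) 𝓘(ℝ, ℝ) ∞ (fun x => f x α β) U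
  f_nondeg : ∀ x ∈ U, (f x).det ≠ 0
  /-- the contravariant affine connection, `Γ x α β γ = Γ_{βγ}^α`, `∇_{e_γ} e_β = Γ_{βγ}^α e_α` -/
  Γ : M → Fin n → Fin n → Fin n → ℝ
  Γ_smooth : ∀ α β γ, ContMDiffOn (𝓡 n) 𝓘(ℝ, ℝ) ∞ (fun x => Γ x α β γ) U
  /-- the covariant affine connection, `P x α β γ = P_{βγ}^α`, `∇_{e_γ} e^α = P_{βγ}^α e^β` -/
  P : M → Fin n → Fin n → Fin n → ℝ
  P_smooth : ∀ α β γ, ContMDiffOn (𝓡 n) 𝓘(ℝ, ℝ) ∞ (fun x => P x α β γ) U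
  /-- covariant differentiation commutes with the contraction `S` -/
  compat : ∀ x ∈ U, ∀ α β γ,
    (mfderiv (𝓡 n) 𝓘(ℝ, ℝ) (fun y => f y α β) x (frame γ x) : ℝ)
      = ∑ δ, P x α δ γ * f x δ β + ∑ δ, Γ x δ β γ * f x α δ
  /-- the covariant metric `g_{αβ}` -/
  g : M → Matrix (Fin n) (Fin n) ℝ
  g_smooth : ∀ α β, ContMDiffOn (𝓡 n) 𝓘(ℝ, ℝ) ∞ (fun x => g x α β) U
  g_symm : ∀ x ∈ U, (g x).IsSymm
  g_nondeg : ∀ x ∈ U, (g x).det ≠ 0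

variable {n : ℕ} {M : Type*} [TopologicalSpace M]
  [ChartedSpace (EuclideanSpace ℝ (Fin n)) M] [IsManifold (𝓡 n) ∞ M]

namespace Space

variable (X : Space n M)

/-! ### Contractions and metrics -/

/-- `v^{ᾱ} = f^α_β v^β`. -/
def barUp (v : VecField n M) : VecField n M := fun x α => ∑ β, X.f x α β * v x β

/-- `p_{ᾱ} = f^β_α p_β`. -/
def barLow (p : CovecField n M) : CovecField n M := fun x α => ∑ β, X.f x β α * p x β

/-- The covector field `g(v) = g_{α β̄} v^β e^α`. -/
def lower (v : VecField n M) : CovecField n M := fun x α => ∑ β, X.g x α β * X.barUp v x β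

/-- The contraction `p(v) = p_α v^{ᾱ}`. -/
def pair (p : CovecField n M) (v : VecField n M) : M → ℝ := fun x => ∑ α, p x α * X.barUp v x α

/-- The scalar `e = g(u,u)`. -/
def normSq (u : VecField n M) : M → ℝ := X.pair (X.lower u) u

/-- `G(v) = G_α^β v^{ᾱ} e_β`. -/
def apply (G : MixedField n M) (v : VecField n M) : VecField n M :=
  fun x β => ∑ α, G x α β * X.barUp v x α

/-- `[p](G) = p_{β̄} G_α^β e^α`. -/
def coapply (p : CovecField n M) (G : MixedField n M) : CovecField n M :=
  fun x α => ∑ β, X.barLow p x β * G x α β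

/-- The contravariant metric `g^{αβ}`, inverse to `g` with respect to the contraction:
`g_{ᾱ β̄} g^{βγ} = δ_α^γ`, i.e. `ḡ(g(v)) = v`. -/
def gInv : ContraField n M := fun x α β => ((X.f x)ᵀ * X.g x * X.f x)⁻¹ α β

/-- The projective metric `h^u = ḡ - (1/e) u ⊗ u`. -/
def hUp (u : VecField n M) : ContraField n M :=
  fun x α β => X.gInv x α β - 1 / X.normSq u x * (u x α * u x β)

/-- `A(p) = A^{αβ} p_{β̄} e_α`. -/
def contractRight (A : ContraField n M) (p : CovecField n M) : VecField n M :=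
  fun x α => ∑ β, A x α β * X.barLow p x β

/-- `[p]A = p_{ᾱ} A^{αβ} e_β`. -/
def contractLeft (p : CovecField n M) (A : ContraField n M) : VecField n M :=
  fun x β => ∑ α, X.barLow p x α * A x α β

/-! ### Projections of a mixed tensor field of type 1 along and orthogonal to `u` -/

/-- `ρ_G = (1/e²) [g(u)](G)(u)`. -/
def rho (u : VecField n M) (G : MixedField n M) : M → ℝ :=
  fun x => 1 / X.normSq u x ^ 2 * X.pair (X.lower u) (X.apply G u) x

/-- `^Gπ = (1/e) [g(u)](G) h^u`. -/
def piProj (u : VecField n M) (G : MixedField n M) : VecField n M :=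
  fun x => (1 / X.normSq u x) • X.contractLeft (X.coapply (X.lower u) G) (X.hUp u) x

/-- `^Gs = (1/e) h^u(g)(G)(u)`. -/
def sProj (u : VecField n M) (G : MixedField n M) : VecField n M :=
  fun x => (1 / X.normSq u x) • X.contractRight (X.hUp u) (X.lower (X.apply G u)) x

/-- `^GS = h^u(g)(G) h^u`: for each `β`, the vector `G_κ^δ h^{κ̄ β} e_δ` is projected by `h^u(g)`. -/
def stressProj (u : VecField n M) (G : MixedField n M) : ContraField n M :=
  fun x α β => X.contractRight (X.hUp u)
    (X.lower (X.apply G (fun y κ => X.hUp u y κ β))) x α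

/-- The momentum density `p_G = ρ_G u + ^Gπ`. -/
def momentum (u : VecField n M) (G : MixedField n M) : VecField n M :=
  fun x => X.rho u G x • u x + X.piProj u G x

/-- The energy flux density `e_G = G(u)`. -/
def energyFlux (u : VecField n M) (G : MixedField n M) : VecField n M := X.apply G u

/-! The projections of the variational tensor `Q` carry the opposite sign:
`Q = -ρ_Q u ⊗ g(u) - u ⊗ g(^Qπ) - ^Qs ⊗ g(u) - (^QS)g`. -/

/-- `ρ_Q = -(1/e²) [g(u)](Q)(u)`. -/
def rhoQ (u : VecField n M) (Q : MixedField n M) : M → ℝ := fun x => -X.rho u Q x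

/-- `^Qπ = -(1/e) [g(u)](Q) h^u`. -/
def piQ (u : VecField n M) (Q : MixedField n M) : VecField n M := fun x => -X.piProj u Q x

/-- `^Qs = -(1/e) h^u(g)(Q)(u)`. -/
def sQ (u : VecField n M) (Q : MixedField n M) : VecField n M := fun x => -X.sProj u Q x

/-- `^QS = -h^u(g)(Q) h^u`. -/
def stressQ (u : VecField n M) (Q : MixedField n M) : ContraField n M :=
  fun x => -X.stressProj u Q x

/-- `p_Q = ρ_Q u + ^Qπ`. -/
def momentumQ (u : VecField n M) (Q : MixedField n M) : VecField n M :=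
  fun x => X.rhoQ u Q x • u x + X.piQ u Q x

/-- `e_Q = -Q(u)`. -/
def energyFluxQ (u : VecField n M) (Q : MixedField n M) : VecField n M :=
  fun x => -X.apply Q u x

/-! ### Covariant differentiation -/

/-- `e_γ φ`. -/
def dirDeriv (γ : Fin n) (φ : M → ℝ) (x : M) : ℝ :=
  mfderiv (𝓡 n) 𝓘(ℝ, ℝ) φ x (X.frame γ x)

/-- The covariant derivative `K^A_{B/γ}`; the derivative index `γ` is the last covariant index. -/
def covD {k l : ℕ} (K : TField n M k l) : TField n M k (l + 1) := fun x A C =>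
  let B : Fin l → Fin n := fun j => C j.castSucc
  let γ : Fin n := C (Fin.last l)
  X.dirDeriv γ (fun y => K y A B) x
    + ∑ i, ∑ β, X.Γ x (A i) β γ * K x (Function.update A i β) B
    + ∑ j, ∑ β, X.P x β (B j) γ * K x A (Function.update B j β)

/-- The covariant divergence `K^{A γ}_{B/γ}` over the last contravariant index. -/
def div {k l : ℕ} (K : TField n M (k + 1) l) : TField n M k l := fun x A B =>
  ∑ γ, X.covD K x (Fin.snoc (α := fun _ => Fin n) A γ) (Fin.snoc (α := fun _ => Fin n) B γ)

/-- The coefficient of `ξ^α_{/β}` in the Lie derivative `(£_ξ K)^A_B`. A contravariant index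
contributes `-K^{… β …} δ^a_α`, a covariant one `K_{… κ …} f^κ_α (f⁻¹)^β_b`, since the Lie
derivative commutes with the contraction. -/
def lieCoeff {k l : ℕ} (K : TField n M k l) (x : M) (α β : Fin n)
    (A : Fin k → Fin n) (B : Fin l → Fin n) : ℝ :=
  -(∑ i, (if A i = α then K x (Function.update A i β) B else 0))
    + ∑ j, ∑ κ, X.f x κ α * (X.f x)⁻¹ β (B j) * K x A (Function.update B j κ)

/-- The metric as a tensor field with two covariant indices. -/
def metricField : TField n M 0 2 := fun x _ B => X.g x (B 0) (B 1)

end Space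

/-! ### Lagrangian systems -/

section Lagrangian

variable {ι : Type*}

/-- Numbers of contravariant indices of the field variables: `none` is the metric. -/
def contraRank (k : ι → ℕ) (a : Option ι) : ℕ := a.elim 0 k

/-- Numbers of covariant indices of the field variables: `none` is the metric. -/
def coRank (l : ι → ℕ) (a : Option ι) : ℕ := a.elim 2 l

/-- Index set of all components of the `m`-th covariant derivatives of the field variables
`K^A_B ∼ (g_{αβ}, V^A_B)`. -/
abbrev JetIdx (n : ℕ) (k l : ι → ℕ) (m : ℕ) :=
  Σ a : Option ι, (Fin (contraRank k a) → Fin n) × (Fin (coRank l a + m) → Fin n)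

/-- Values of the field variables and of their first and second covariant derivatives. -/
abbrev Jet (n : ℕ) (k l : ι → ℕ) :=
  (JetIdx n k l 0 → ℝ) × (JetIdx n k l 1 → ℝ) × (JetIdx n k l 2 → ℝ)

/-- The field variables `K^A_B ∼ (g_{αβ}, V^A_B)`. -/
def fieldVars (X : Space n M) {k l : ι → ℕ} (V : (a : ι) → TField n M (k a) (l a)) :
    (a : Option ι) → TField n M (contraRank k a) (coRank l a)
  | none => X.metricField
  | some a => V a

/-- The values at `x` of the field variables and of their covariant derivatives. -/
def jetAt (X : Space n M) {k l : ι → ℕ} (V : (a : ι) → TField n M (k a) (l a)) (x : M) :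
    Jet n k l :=
  (fun J => fieldVars X V J.1 x J.2.1 J.2.2,
   fun J => X.covD (fieldVars X V J.1) x J.2.1 J.2.2,
   fun J => X.covD (X.covD (fieldVars X V J.1)) x J.2.1 J.2.2)

/-- A Lagrangian system: non-metric tensor fields `V` and a Lagrangian invariant depending on the
field variables and their first and second covariant derivatives, smooth near the jets of the
fields. -/
structure LagrangianSystem [Fintype ι] (X : Space n M) (k l : ι → ℕ) where
  V : (a : ι) → TField n M (k a) (l a)
  V_smooth : ∀ a A B, ContMDiffOn (𝓡 n) 𝓘(ℝ, ℝ) ∞ (fun x => V a x A B) X.U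
  lagr : M × Jet n k l → ℝ
  dom : Set (M × Jet n k l)
  isOpen_dom : IsOpen dom
  jet_mem : ∀ x ∈ X.U, (x, jetAt X V x) ∈ dom
  lagr_smooth : ContMDiffOn ((𝓡 n).prod 𝓘(ℝ, Jet n k l)) 𝓘(ℝ, ℝ) ∞ lagr dom

namespace LagrangianSystem

variable [Fintype ι] {X : Space n M} {k l : ι → ℕ} (𝓛 : LagrangianSystem X k l)

/-- The Lagrangian invariant `L` as a function on the manifold. -/
def L : M → ℝ := fun x => 𝓛.lagr (x, jetAt X 𝓛.V x)

/-- The differential of the Lagrangian invariant with respect to the field variables and their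
covariant derivatives. -/
def dL (x : M) : Jet n k l →L[ℝ] ℝ := fderiv ℝ (fun J => 𝓛.lagr (x, J)) (jetAt X 𝓛.V x)

open Classical in
/-- `∂L/∂K^A_B`, a tensor field with upper indices `B` and lower indices `A`. -/
def partial0 (a : Option ι) : TField n M (coRank l a) (contraRank k a) :=
  fun x B A => 𝓛.dL x (Pi.single ⟨a, A, B⟩ 1, 0, 0)

open Classical in
/-- `∂L/∂K^A_{B/γ}`. -/
def partial1 (a : Option ι) : TField n M (coRank l a + 1) (contraRank k a) :=
  fun x C A => 𝓛.dL x (0, Pi.single ⟨a, A, C⟩ 1, 0)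

open Classical in
/-- `∂L/∂K^A_{B/γ/δ}`. -/
def partial2 (a : Option ι) : TField n M (coRank l a + 1 + 1) (contraRank k a) :=
  fun x C A => 𝓛.dL x (0, 0, Pi.single ⟨a, A, C⟩ 1)

/-- The covariant variational derivative
`δL/δK^A_B = ∂L/∂K^A_B - (∂L/∂K^A_{B/γ})_{/γ} + (∂L/∂K^A_{B/γ/δ})_{/δ/γ}`. -/
def varDeriv (a : Option ι) : TField n M (coRank l a) (contraRank k a) := fun x B A =>
  𝓛.partial0 a x B A - X.div (𝓛.partial1 a) x B A + X.div (X.div (𝓛.partial2 a)) x B A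

/-- The covariant Euler–Lagrange equations `δ_vL/δV^A_B = 0` for the non-metric fields. -/
def EulerLagrange : Prop := ∀ x ∈ X.U, ∀ a : ι, ∀ B A, 𝓛.varDeriv (some a) x B A = 0

/-- The contribution of one field variable to the variational energy-momentum tensor: minus the
coefficient of `ξ^α_{/β}` in `(δL/δK^A_B) (£_ξ K)^A_B`. -/
def variationalPart (a : Option ι) : MixedField n M := fun x α β =>
  -∑ A, ∑ B, 𝓛.varDeriv a x B A * X.lieCoeff (fieldVars X 𝓛.V a) x α β A B

/-- `_vQ`, the part of `Q` belonging to the non-metric fields. -/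
def vQ : MixedField n M := fun x => ∑ a : ι, 𝓛.variationalPart (some a) x

/-- `_gQ`, the part of `Q` belonging to the metric. -/
def gQ : MixedField n M := 𝓛.variationalPart none

/-- The variational energy-momentum tensor of Euler–Lagrange `Q = _vQ + _gQ`. -/
def Q : MixedField n M := fun x => 𝓛.vQ x + 𝓛.gQ x

end LagrangianSystem

end Lagrangian

end LbarN

end

open scoped Matrix

namespace LbarN

variable {n : ℕ} {M : Type*} [TopologicalSpace M]
  [ChartedSpace (EuclideanSpace ℝ (Fin n)) M] [IsManifold (𝓡 n) ∞ M]

namespace Space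

variable (X : Space n M)

/-! Everything is pointwise linear algebra. At a point, a mixed tensor `G` is encoded by the matrix
N of v ↦ G(v) (`endo`) and the metric by the symmetric invertible matrix A (`gram`). All projections
are linear in N, so a decomposition of tensors passes to projections. Conversely, the projections
determine `G` (`eq_zero_of_projections`). With h = `hMat`, hA = 1 - (1/e) u ⊗ Au, so ρ and s
together control Nu, while π and S together control Nh. If all four vanish, then Nu = 0 and Nh = 0,
hence NA⁻¹ = 0 and N = 0. Passing to viscosity tensors adds the same multiple of `Kr` to θ and T,
which cancels (`eq_add_iff_projections`). For the variational tensor, the Euler–Lagrange equations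
annihilate its non-metric part, so `Q` = 0 and θ = T on U. -/

/-- The matrix of the metric as a bilinear form on contravariant vectors, `g_{ᾱ β̄}`. -/
noncomputable def gram (x : M) : Matrix (Fin n) (Fin n) ℝ := (X.f x)ᵀ * X.g x * X.f x

/-- The matrix of the endomorphism `v ↦ G(v)` of the contravariant vectors at `x`. -/
noncomputable def endo (G : MixedField n M) (x : M) : Matrix (Fin n) (Fin n) ℝ :=
  (Matrix.of (G x))ᵀ * X.f x

/-- The matrix of the projective metric `h^u`. -/
noncomputable def hMat (u : VecField n M) (x : M) : Matrix (Fin n) (Fin n) ℝ := Matrix.of (X.hUp u x)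

/-! ### Matrix form of contractions and projections. -/

theorem barUp_eq (v : VecField n M) (x : M) : X.barUp v x = X.f x *ᵥ v x := rfl

theorem barLow_eq (p : CovecField n M) (x : M) : X.barLow p x = (X.f x)ᵀ *ᵥ p x := rfl

theorem lower_eq (v : VecField n M) (x : M) : X.lower v x = (X.g x * X.f x) *ᵥ v x := by
  rw [← Matrix.mulVec_mulVec, ← barUp_eq]; rfl

theorem barLow_lower (v : VecField n M) (x : M) :
    X.barLow (X.lower v) x = X.gram x *ᵥ v x := by
  rw [barLow_eq, lower_eq, Matrix.mulVec_mulVec, gram, Matrix.mul_assoc]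

theorem pair_eq (p : CovecField n M) (v : VecField n M) (x : M) :
    X.pair p v x = X.barLow p x ⬝ᵥ v x := by
  rw [barLow_eq, Matrix.mulVec_transpose, ← Matrix.dotProduct_mulVec, ← barUp_eq]; rfl

theorem apply_eq (G : MixedField n M) (v : VecField n M) (x : M) :
    X.apply G v x = X.endo G x *ᵥ v x := by
  rw [endo, ← Matrix.mulVec_mulVec, ← barUp_eq]; rfl

/-- Barred covectors act as rows on contravariant vectors, so a contraction from the left involves
the same matrix `endo` as one from the right. -/
theorem barLow_coapply (p : CovecField n M) (G : MixedField n M) (x : M) :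
    X.barLow (X.coapply p G) x = X.barLow p x ᵥ* X.endo G x := by
  have h : X.coapply p G x = X.barLow p x ᵥ* (Matrix.of (G x))ᵀ := by
    rw [Matrix.vecMul_transpose]
    ext α
    exact Finset.sum_congr rfl fun β _ => mul_comm _ _
  rw [barLow_eq, h, Matrix.mulVec_transpose, Matrix.vecMul_vecMul, endo]

theorem rho_eq (u : VecField n M) (G : MixedField n M) (x : M) :
    X.rho u G x = 1 / X.normSq u x ^ 2 * (X.gram x *ᵥ u x ⬝ᵥ X.endo G x *ᵥ u x) := by
  rw [rho, pair_eq, barLow_lower, apply_eq]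

theorem piProj_eq (u : VecField n M) (G : MixedField n M) (x : M) :
    X.piProj u G x
      = (1 / X.normSq u x) • ((X.gram x *ᵥ u x) ᵥ* (X.endo G x * X.hMat u x)) := by
  rw [← Matrix.vecMul_vecMul, ← barLow_lower, ← barLow_coapply]; rfl

theorem sProj_eq (u : VecField n M) (G : MixedField n M) (x : M) :
    X.sProj u G x
      = (1 / X.normSq u x) • ((X.hMat u x * X.gram x) *ᵥ (X.endo G x *ᵥ u x)) := by
  rw [← Matrix.mulVec_mulVec, ← apply_eq, ← barLow_lower]; rfl

theorem stressProj_eq (u : VecField n M) (G : MixedField n M) (x : M) :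
    Matrix.of (X.stressProj u G x)
      = X.hMat u x * X.gram x * (X.endo G x * X.hMat u x) := by
  ext α β
  -- For fixed β the vector fed into G is the β-th column of h.
  have h : X.stressProj u G x α β
      = (X.hMat u x *ᵥ X.barLow (X.lower (X.apply G (fun y κ => X.hUp u y κ β))) x) α := rfl
  rw [Matrix.of_apply, h, barLow_lower, apply_eq, Matrix.mulVec_mulVec, Matrix.mulVec_mulVec,
    ← Matrix.mul_assoc]
  rfl

variable {X} {u : VecField n M} {G G₁ G₂ : MixedField n M} {x : M}

/-! ### Additivity of the projections -/

/-- Equality at the single point `x` suffices because no derivative of G enters; the fields are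
related only on U. -/
theorem endo_add (h : G x = G₁ x + G₂ x) : X.endo G x = X.endo G₁ x + X.endo G₂ x := by
  rw [endo, h, ← Matrix.of_add_of, Matrix.transpose_add, Matrix.add_mul]; rfl

theorem apply_add (v : VecField n M) (h : G x = G₁ x + G₂ x) :
    X.apply G v x = X.apply G₁ v x + X.apply G₂ v x := by
  simp only [apply_eq, endo_add h, Matrix.add_mulVec]

theorem rho_add (h : G x = G₁ x + G₂ x) : X.rho u G x = X.rho u G₁ x + X.rho u G₂ x := by
  simp only [rho_eq, endo_add h, Matrix.add_mulVec, dotProduct_add, mul_add]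

theorem piProj_add (h : G x = G₁ x + G₂ x) :
    X.piProj u G x = X.piProj u G₁ x + X.piProj u G₂ x := by
  simp only [piProj_eq, endo_add h, Matrix.add_mul, Matrix.vecMul_add, smul_add]

theorem sProj_add (h : G x = G₁ x + G₂ x) :
    X.sProj u G x = X.sProj u G₁ x + X.sProj u G₂ x := by
  simp only [sProj_eq, endo_add h, Matrix.add_mulVec, Matrix.mulVec_add, smul_add]

theorem stressProj_add (h : G x = G₁ x + G₂ x) :
    X.stressProj u G x = X.stressProj u G₁ x + X.stressProj u G₂ x := by
  apply Matrix.of.injective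
  rw [← Matrix.of_add_of]
  simp only [stressProj_eq, endo_add h, Matrix.add_mul, Matrix.mul_add]

theorem momentum_add (h : G x = G₁ x + G₂ x) :
    X.momentum u G x = X.momentum u G₁ x + X.momentum u G₂ x := by
  simp only [momentum, rho_add h, piProj_add h, add_smul]
  abel

theorem momentumQ_eq (Q : MixedField n M) : X.momentumQ u Q x = -X.momentum u Q x := by
  simp only [momentumQ, rhoQ, piQ, momentum, neg_smul, neg_add]

/-! ### A mixed tensor field is determined by its projections -/

theorem hMat_eq : X.hMat u x
    = (X.gram x)⁻¹ - (1 / X.normSq u x) • Matrix.vecMulVec (u x) (u x) := rfl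

theorem isUnit_det_gram (hx : x ∈ X.U) : IsUnit (X.gram x).det := by
  rw [gram, Matrix.det_mul, Matrix.det_mul, Matrix.det_transpose, isUnit_iff_ne_zero]
  exact mul_ne_zero (mul_ne_zero (X.f_nondeg x hx) (X.g_nondeg x hx)) (X.f_nondeg x hx)

theorem gram_transpose (hx : x ∈ X.U) : (X.gram x)ᵀ = X.gram x := by
  rw [gram, Matrix.transpose_mul, Matrix.transpose_mul, Matrix.transpose_transpose,
    (X.g_symm x hx).eq, Matrix.mul_assoc]

/-- A vector splits into its parts orthogonal to and along `u`. -/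
theorem hMat_mul_gram (hx : x ∈ X.U) : X.hMat u x * X.gram x
    = 1 - (1 / X.normSq u x) • Matrix.vecMulVec (u x) (X.gram x *ᵥ u x) := by
  rw [hMat_eq, Matrix.sub_mul, Matrix.nonsing_inv_mul _ (isUnit_det_gram hx), Matrix.smul_mul,
    Matrix.vecMulVec_mul, ← Matrix.mulVec_transpose, gram_transpose hx]

theorem eq_zero_of_projections (hx : x ∈ X.U) (hu : X.normSq u x ≠ 0)
    (hρ : X.rho u G x = 0) (hπ : X.piProj u G x = 0) (hs : X.sProj u G x = 0)
    (hS : X.stressProj u G x = 0) : G x = 0 := by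
  have hS' : Matrix.of (X.stressProj u G x) = 0 := by rw [hS]; rfl
  rw [rho_eq, mul_eq_zero, or_iff_right (one_div_ne_zero (pow_ne_zero 2 hu))] at hρ
  rw [piProj_eq, smul_eq_zero_iff_right (one_div_ne_zero hu)] at hπ
  rw [sProj_eq, smul_eq_zero_iff_right (one_div_ne_zero hu)] at hs
  rw [stressProj_eq] at hS'
  rw [hMat_mul_gram hx] at hs hS'
  -- `hs` says Nu - (1/e)⟨Au, Nu⟩u = 0, and `hρ` removes the component along u.
  have hNu : X.endo G x *ᵥ u x = 0 := by
    rwa [Matrix.sub_mulVec, Matrix.smul_mulVec, Matrix.vecMulVec_mulVec, hρ, Matrix.one_mulVec,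
      MulOpposite.op_zero, zero_smul, smul_zero, sub_zero] at hs
  -- The same splitting applied to the columns of Nh, whose components along u vanish by `hπ`.
  have hNh : X.endo G x * X.hMat u x = 0 := by
    rwa [Matrix.sub_mul, Matrix.smul_mul, Matrix.vecMulVec_mul, hπ, Matrix.vecMulVec_zero,
      smul_zero, sub_zero, Matrix.one_mul] at hS'
  have hN : X.endo G x = 0 := by
    -- Since Nu = 0, the u ⊗ u term of h drops out and Nh = NA⁻¹.
    rw [hMat_eq, Matrix.mul_sub, Matrix.mul_smul, Matrix.mul_vecMulVec, hNu,
      Matrix.zero_vecMulVec, smul_zero, sub_zero] at hNh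
    rw [← Matrix.mul_one (X.endo G x), ← Matrix.nonsing_inv_mul _ (isUnit_det_gram hx),
      ← Matrix.mul_assoc, hNh, Matrix.zero_mul]
  have hf : IsUnit (X.f x).det := isUnit_iff_ne_zero.2 (X.f_nondeg x hx)
  have hG : (Matrix.of (G x))ᵀ = 0 := by
    rw [← Matrix.mul_one (Matrix.of (G x))ᵀ, ← Matrix.mul_nonsing_inv _ hf, ← Matrix.mul_assoc]
    change X.endo G x * _ = 0
    rw [hN, Matrix.zero_mul]
  exact Matrix.of.injective (Matrix.transpose_eq_zero.1 hG)

/-- Two mixed tensors with the same projections along and orthogonal to `u` coincide. -/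
theorem ext_projections (hx : x ∈ X.U) (hu : X.normSq u x ≠ 0)
    (hρ : X.rho u G₁ x = X.rho u G₂ x) (hπ : X.piProj u G₁ x = X.piProj u G₂ x)
    (hs : X.sProj u G₁ x = X.sProj u G₂ x) (hS : X.stressProj u G₁ x = X.stressProj u G₂ x) :
    G₁ x = G₂ x := by
  have h : G₁ x = G₂ x + (G₁ - G₂) x := (add_sub_cancel _ _).symm
  have h0 : (G₁ - G₂) x = 0 := eq_zero_of_projections hx hu
    (left_eq_add.1 (hρ.symm.trans (rho_add h))) (left_eq_add.1 (hπ.symm.trans (piProj_add h)))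
    (left_eq_add.1 (hs.symm.trans (sProj_add h))) (left_eq_add.1 (hS.symm.trans (stressProj_add h)))
  exact sub_eq_zero.1 h0

theorem projections_of_eq_zero (h : G x = 0) :
    X.rho u G x = 0 ∧ X.piProj u G x = 0 ∧ X.sProj u G x = 0 ∧ X.stressProj u G x = 0 := by
  -- By additivity each projection equals its own double, so it vanishes.
  have h2 : G x = G x + G x := by rw [h, add_zero]
  exact ⟨left_eq_add.1 (rho_add h2), left_eq_add.1 (piProj_add h2), left_eq_add.1 (sProj_add h2),
    left_eq_add.1 (stressProj_add h2)⟩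

/-- A decomposition of a mixed tensor is equivalent to the decomposition of its projections,
those orthogonal to `u` being taken of the viscosity tensors. -/
theorem eq_add_iff_projections (L : M → ℝ) (hx : x ∈ X.U) (hu : X.normSq u x ≠ 0)
    (θ T Q : MixedField n M) :
    θ x = T x + Q x ↔
      X.rho u θ x = X.rho u T x + X.rho u Q x ∧
      X.piProj u (viscous L θ) x = X.piProj u (viscous L T) x + X.piProj u Q x ∧
      X.sProj u (viscous L θ) x = X.sProj u (viscous L T) x + X.sProj u Q x ∧
      X.stressProj u (viscous L θ) x
        = X.stressProj u (viscous L T) x + X.stressProj u Q x := by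
  constructor
  · intro h
    have hv : viscous L θ x = viscous L T x + Q x := by
      simp only [viscous, h]; abel
    exact ⟨rho_add h, piProj_add hv, sProj_add hv, stressProj_add hv⟩
  · rintro ⟨hρ, hπ, hs, hS⟩
    have hadd : (viscous L T + Q) x = viscous L T x + Q x := rfl
    -- Only ρ is given unbarred; the correction from L·Kr is the same for θ and T.
    have hρv (G : MixedField n M) :
        X.rho u (viscous L G) x = X.rho u G x + X.rho u (fun y => L y • Kr y) x := rho_add rfl
    have h : viscous L θ x = (viscous L T + Q) x := by
      apply ext_projections hx hu
      · rw [rho_add hadd, hρv, hρv, hρ]; ring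
      · rw [piProj_add hadd, hπ]
      · rw [sProj_add hadd, hs]
      · rw [stressProj_add hadd, hS]
    rw [hadd] at h
    simp only [viscous] at h
    apply add_right_cancel (b := L x • Kr x)
    rw [h]; abel

end Space

/-! ### Vanishing of the non-metric variational part. -/

namespace LagrangianSystem

variable {ι : Type*} [Fintype ι] {X : Space n M} {k l : ι → ℕ} {𝓛 : LagrangianSystem X k l}

theorem EulerLagrange.vQ_eq_zero (h : 𝓛.EulerLagrange) {x : M} (hx : x ∈ X.U) :
    𝓛.vQ x = 0 := by
  refine Finset.sum_eq_zero fun a _ => ?_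
  ext α β
  have h0 : ∀ A B, 𝓛.varDeriv (some a) x B A = 0 := fun A B => h x hx a B A
  simp only [variationalPart, h0, zero_mul, Finset.sum_const_zero, neg_zero, Pi.zero_apply]

end LagrangianSystem

end LbarN

theorem mainTheorem2 {n : ℕ} {M : Type*} [TopologicalSpace M]
    [ChartedSpace (EuclideanSpace ℝ (Fin n)) M] [IsManifold (𝓡 n) ∞ M]
    {ι : Type*} [Fintype ι] {k l : ι → ℕ}
    (X : LbarN.Space n M) (𝓛 : LbarN.LagrangianSystem X k l)
    (u : LbarN.VecField n M) (hu : ∀ x ∈ X.U, X.normSq u x ≠ 0)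
    (θ T Q : LbarN.MixedField n M) :
    ((∀ x ∈ X.U, θ x - T x = Q x) ↔
      ∀ x ∈ X.U,
        X.rho u θ x = X.rho u T x - X.rhoQ u Q x ∧
        X.piProj u (LbarN.viscous 𝓛.L θ) x = X.piProj u (LbarN.viscous 𝓛.L T) x - X.piQ u Q x ∧
        X.sProj u (LbarN.viscous 𝓛.L θ) x = X.sProj u (LbarN.viscous 𝓛.L T) x - X.sQ u Q x ∧
        X.stressProj u (LbarN.viscous 𝓛.L θ) x
          = X.stressProj u (LbarN.viscous 𝓛.L T) x - X.stressQ u Q x) ∧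
    ((∀ x ∈ X.U, θ x - T x = Q x) →
      ∀ x ∈ X.U,
        X.momentum u θ x = X.momentum u T x - X.momentumQ u Q x ∧
        X.energyFlux u θ x = X.energyFlux u T x - X.energyFluxQ u Q x) ∧
    ((∀ x ∈ X.U, θ x - T x = 𝓛.Q x) →
      𝓛.EulerLagrange → (∀ x ∈ X.U, 𝓛.gQ x = 0) →
      ∀ x ∈ X.U,
        X.rhoQ u 𝓛.Q x = 0 ∧ X.piQ u 𝓛.Q x = 0 ∧ X.sQ u 𝓛.Q x = 0 ∧ X.stressQ u 𝓛.Q x = 0 ∧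
        X.rho u θ x = X.rho u T x ∧
        X.piProj u (LbarN.viscous 𝓛.L θ) x = X.piProj u (LbarN.viscous 𝓛.L T) x ∧
        X.sProj u (LbarN.viscous 𝓛.L θ) x = X.sProj u (LbarN.viscous 𝓛.L T) x ∧
        X.stressProj u (LbarN.viscous 𝓛.L θ) x = X.stressProj u (LbarN.viscous 𝓛.L T) x ∧
        X.momentum u θ x = X.momentum u T x ∧
        X.energyFlux u θ x = X.energyFlux u T x) := by
  have decomp (Q' : LbarN.MixedField n M) (h : ∀ x ∈ X.U, θ x - T x = Q' x) {x : M}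
      (hx : x ∈ X.U) : θ x = T x + Q' x := sub_eq_iff_eq_add'.1 (h x hx)
  refine ⟨forall₂_congr fun x hx => ?_, fun h x hx => ?_, fun h hEL hg x hx => ?_⟩
  -- The reversed signs for Q turn the stated differences into sums.
  · simp only [LbarN.Space.rhoQ, LbarN.Space.piQ, LbarN.Space.sQ, LbarN.Space.stressQ,
      sub_neg_eq_add]
    rw [sub_eq_iff_eq_add']
    exact LbarN.Space.eq_add_iff_projections 𝓛.L hx (hu x hx) θ T Q
  · have hd := decomp Q h hx
    rw [LbarN.Space.momentumQ_eq, LbarN.Space.energyFluxQ, sub_neg_eq_add, sub_neg_eq_add]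
    exact ⟨LbarN.Space.momentum_add hd, LbarN.Space.apply_add u hd⟩
  · have hQ : 𝓛.Q x = 0 := by
      rw [LbarN.LagrangianSystem.Q, hEL.vQ_eq_zero hx, hg x hx, add_zero]
    have hθ : θ x = T x := by rw [decomp 𝓛.Q h hx, hQ, add_zero]
    obtain ⟨hρ, hπ, hs, hS⟩ := LbarN.Space.projections_of_eq_zero (X := X) (u := u) hQ
    obtain ⟨hρ', hπ', hs', hS'⟩ :=
      (LbarN.Space.eq_add_iff_projections 𝓛.L hx (hu x hx) θ T 𝓛.Q).1 (decomp 𝓛.Q h hx)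
    rw [hρ, add_zero] at hρ'
    rw [hπ, add_zero] at hπ'
    rw [hs, add_zero] at hs'
    rw [hS, add_zero] at hS'
    refine ⟨neg_eq_zero.2 hρ, neg_eq_zero.2 hπ, neg_eq_zero.2 hs, neg_eq_zero.2 hS,
      hρ', hπ', hs', hS', ?_, ?_⟩
    -- Momentum and energy flux depend on θ only through its value at x.
    · simp only [LbarN.Space.momentum, LbarN.Space.rho_eq, LbarN.Space.piProj_eq,
        LbarN.Space.endo, hθ]
    · simp only [LbarN.Space.energyFlux, LbarN.Space.apply_eq, LbarN.Space.endo, hθ]
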